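/- Let $\mathbb{K}$ be a commutative ring and $q\in\mathbb{K}$. For a surjective map $t:\{1,\dots,n\}\to\{1,\dots,k\}$ the arity of $v\in\{1,\dots,k\}$ is $|v|:=\# t^{-1}(v)+1$. If $t_j:\{1,\dots,\# t^{-1}(j)\}\to\{1,\dots,m_j\}$ ($1\le j\le k$) are surjective maps, the substitution $(t;t_1,\dots,t_k):\{1,\dots,n\}\to\{1,\dots,m_1+\dots+m_k\}$ is given by $(t;t_1,\dots,t_k)(a)=m_1+\dots+m_{j-1}+t_j(b)$ whenever $t(a)=j$ and $a$ is the $b$-th element of $t^{-1}(j)$. A permutad $\mathcal{P}$ over $\mathbb{K}$ is a family of $\mathbb{K}$-modules $\mathcal{P}_n$, $n\ge 1$, with linear maps $\Gamma(t;-):\mathcal{P}_{|1|}\otimes\dots\otimes\mathcal{P}_{|k|}\to\mathcal{P}_{n+1}$ for all surjective maps $t:\{1,\dots,n\}\to\{1,\dots,k\}$, $n\ge 0$, which are compatible with substitution, such that $\Gamma(t;x)=x$ when $n\ge 1$ and $k=1$, and such that $\mathcal{P}_1$ is free of rank one on the identity operation $\mathrm{id}=\Gamma(1_0;\,)$, where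 $1_0$ is the permutation of the empty set. Let $q\text{-}\mathrm{permAs}$ be the permutad generated by one operation $\mu$ of arity $2$ with the single relation $$\Gamma((12);\mu,\mu)=q\,\Gamma(1_2;\mu,\mu)\qquad(\text{that is, } \mu\circ_2\mu=q\,\mu\circ_1\mu),$$ i.e. the quotient of the free permutad on $\mu$ by the ideal generated by $\Gamma((12);\mu,\mu)-q\,\Gamma(1_2;\mu,\mu)$. Then for every $n\ge 0$ the module $(q\text{-}\mathrm{permAs})_{n+1}$ of operations of arity $n+1$ is free of rank one, with basis $\Gamma(1_n;\mu,\dots,\mu)$ ($n$ copies of $\mu$, where $1_n$ is the identity permutation of $\{1,\dots,n\}$; this is $\mathrm{id}$ for $n=0$). Moreover, for every permutation $\sigma\in\mathbb{S}_n$, considered as a surjective map from $\{1,\dots,n\}$ to itself, $$\Gamma(\sigma;\mu,\dots,\mu)=q^{\ell(\sigma)}\,\Gamma(1_n;\mu,\dots,\mu),$$ where the Coxeter length $\ell(\sigma)$ is the least number of factors in an expression of $\sigma$ as a product of adjacent transpositions $(i\ i+1)$. -/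

import Mathlib

/-!
# Permutads

`Surj n k` is the set of surjective maps from an `n`-element to a `k`-element chain
(everything is indexed from `0`).  The arity of a vertex `v` of a surjection is the cardinality of
its fibre plus one; throughout, a family indexed by `ℕ` is shifted accordingly, so that
`P.obj n` is the module of operations of arity `n + 1`.
-/

namespace Permutads

universe u v

/-! ### Surjections and substitution -/

/-- Surjective maps `{1, …, n} → {1, …, k}`. For `n = k` these are the permutations, and for
`n = k = 0` there is exactly one. -/
abbrev Surj (n k : ℕ) : Type := {t : Fin n → Fin k // Function.Surjective t}

instance (n k : ℕ) : CoeFun (Surj n k) (fun _ => Fin n → Fin k) := ⟨Subtype.val⟩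

/-- The fibre of a map over a vertex. -/
abbrev Fibre {n k : ℕ} (t : Fin n → Fin k) (j : Fin k) : Type := {a : Fin n // t a = j}

/-- The number of elements of the fibre over `j`; the arity of the vertex `j` is this number
plus one. -/
def fibreCard {n k : ℕ} (t : Fin n → Fin k) (j : Fin k) : ℕ := Fintype.card (Fibre t j)

/-- The increasing bijection from the fibre over `j` to `Fin (fibreCard t j)`: it sends the
`b`-th element of the fibre to `b`. -/
def position {n k : ℕ} (t : Fin n → Fin k) (j : Fin k) :
    Fibre t j ≃o Fin (fibreCard t j) :=
  (monoEquivOfFin (Fibre t j) rfl).symm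

/-- Substitution of maps: if `t a = j` and `a` is the `b`-th element of the fibre over `j`, then
`a` is sent to `m 1 + ⋯ + m (j - 1) + s j b`. -/
def substFun {n k : ℕ} (t : Fin n → Fin k) {m : Fin k → ℕ}
    (s : ∀ j, Fin (fibreCard t j) → Fin (m j)) (a : Fin n) : Fin (∑ j, m j) :=
  finSigmaFinEquiv ⟨t a, s (t a) (position t (t a) ⟨a, rfl⟩)⟩

theorem substFun_eq {n k : ℕ} (t : Fin n → Fin k) {m : Fin k → ℕ}
    (s : ∀ j, Fin (fibreCard t j) → Fin (m j)) (a : Fin n) (j : Fin k) (h : t a = j) :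
    substFun t s a = finSigmaFinEquiv ⟨j, s j (position t j ⟨a, h⟩)⟩ := by
  subst h; rfl

/-- Substitution `(t; s₁, …, s_k)` of surjections. -/
def Surj.subst {n k : ℕ} (t : Surj n k) {m : Fin k → ℕ}
    (s : ∀ j, Surj (fibreCard t j) (m j)) : Surj n (∑ j, m j) :=
  ⟨substFun t (fun j => s j), by
    intro w
    obtain ⟨⟨j, v⟩, rfl⟩ := finSigmaFinEquiv.surjective w
    obtain ⟨b, rfl⟩ := (s j).2 v
    obtain ⟨⟨a, h⟩, rfl⟩ := (position t j).surjective b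
    exact ⟨a, substFun_eq t (fun j => s j) a j h⟩⟩

/-- The corolla: the unique surjection onto a one-element set. -/
def corolla (n : ℕ) (hn : 0 < n) : Surj n 1 :=
  ⟨fun _ => 0, fun _ => ⟨⟨0, hn⟩, Subsingleton.elim _ _⟩⟩

/-- A permutation, considered as a surjection. -/
def permSurj {n : ℕ} (σ : Equiv.Perm (Fin n)) : Surj n n := ⟨σ, σ.surjective⟩

theorem fibreCard_corolla (n : ℕ) (hn : 0 < n) (j : Fin 1) :
    fibreCard (corolla n hn) j = n := by
  have h : ∀ a, corolla n hn a = j := fun a => Subsingleton.elim _ _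
  simp [fibreCard, Fibre, Fintype.card_subtype, h]

theorem fibreCard_permSurj {n : ℕ} (σ : Equiv.Perm (Fin n)) (j : Fin n) :
    fibreCard (permSurj σ) j = 1 := by
  rw [fibreCard, Fintype.card_eq_one_iff]
  refine ⟨⟨σ.symm j, by simp [permSurj]⟩, ?_⟩
  rintro ⟨a, ha⟩
  apply Subtype.ext
  change a = σ.symm j
  rw [Equiv.eq_symm_apply]
  exact ha

theorem substFun_eq_iff {n k : ℕ} (t : Fin n → Fin k) {m : Fin k → ℕ}
    (s : ∀ j, Fin (fibreCard t j) → Fin (m j)) (a : Fin n) (j : Fin k) (v : Fin (m j)) :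
    substFun t s a = finSigmaFinEquiv ⟨j, v⟩ ↔
      ∃ h : t a = j, s j (position t j ⟨a, h⟩) = v := by
  constructor
  · intro h
    have h' := finSigmaFinEquiv.injective h
    have hj : t a = j := congrArg Sigma.fst h'
    subst hj
    exact ⟨rfl, eq_of_heq (Sigma.mk.inj h').2⟩
  · rintro ⟨h, rfl⟩
    exact substFun_eq t s a j h

/-- The fibre of a substitution is a fibre of one of the substituted maps. -/
def fibreSubst {n k : ℕ} (t : Fin n → Fin k) {m : Fin k → ℕ}
    (s : ∀ j, Fin (fibreCard t j) → Fin (m j)) (j : Fin k) (v : Fin (m j)) :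
    Fibre (substFun t s) (finSigmaFinEquiv ⟨j, v⟩) ≃o Fibre (s j) v where
  toFun a := ⟨position t j ⟨a.1, ((substFun_eq_iff t s a.1 j v).1 a.2).1⟩,
    ((substFun_eq_iff t s a.1 j v).1 a.2).2⟩
  invFun b := ⟨((position t j).symm b.1).1,
    (substFun_eq_iff t s _ j v).2 ⟨((position t j).symm b.1).2, by simp [b.2]⟩⟩
  left_inv a := by simp
  right_inv b := by simp
  map_rel_iff' := by
    intro a b
    simp [← Subtype.coe_le_coe]

theorem fibreCard_subst {n k : ℕ} (t : Fin n → Fin k) {m : Fin k → ℕ}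
    (s : ∀ j, Fin (fibreCard t j) → Fin (m j)) (j : Fin k) (v : Fin (m j)) :
    fibreCard (substFun t s) (finSigmaFinEquiv ⟨j, v⟩) = fibreCard (s j) v :=
  Fintype.card_congr (fibreSubst t s j v).toEquiv

theorem fibreCard_subst' {n k : ℕ} (t : Surj n k) {m : Fin k → ℕ}
    (s : ∀ j, Surj (fibreCard t j) (m j)) (w : Fin (∑ j, m j)) :
    fibreCard (s (finSigmaFinEquiv.symm w).1) (finSigmaFinEquiv.symm w).2 =
      fibreCard (t.subst s) w := by
  have h := fibreCard_subst t (fun j => s j) (finSigmaFinEquiv.symm w).1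
    (finSigmaFinEquiv.symm w).2
  rw [← h]
  simp [Surj.subst]

/-- Transport along an equality of indices. -/
def castIdx {A : ℕ → Type v} {m n : ℕ} (h : m = n) (x : A m) : A n := h ▸ x

/-! ### Permutads -/

/-- A permutad over `K`, i.e. a unital algebra over the monad of surjections: an arity-graded
module with, for each surjection `t` with `n` elements in the source, a linear map
`Γ(t; -)` from the tensor product of the modules of operations attached to the vertices of `t`
(given here as a multilinear map) to the module of operations of arity `n + 1`.

`obj n` is the module of operations of arity `n + 1`. -/
structure Permutad (K : Type u) [CommRing K] where
  /-- the operations of arity `n + 1` -/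
  obj : ℕ → Type v
  [addCommGroup : ∀ n, AddCommGroup (obj n)]
  [module : ∀ n, Module K (obj n)]
  /-- the composition `Γ(t; x₁, …, x_k)` -/
  comp : ∀ {n k : ℕ} (t : Surj n k),
    MultilinearMap K (fun j : Fin k => obj (fibreCard t j)) (obj n)
  /-- compatibility with substitution -/
  assoc : ∀ {n k : ℕ} (t : Surj n k) {m : Fin k → ℕ} (s : ∀ j, Surj (fibreCard t j) (m j))
    (x : ∀ (j : Fin k) (i : Fin (m j)), obj (fibreCard (s j) i)),
    comp t (fun j => comp (s j) (x j)) =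
      comp (t.subst s) (fun w => castIdx (fibreCard_subst' t s w)
        (x (finSigmaFinEquiv.symm w).1 (finSigmaFinEquiv.symm w).2))
  /-- compatibility with the unit of the monad: decorated corollas -/
  unit : ∀ (n : ℕ) (hn : 0 < n) (x : obj n),
    comp (corolla n hn) (fun j => castIdx (fibreCard_corolla n hn j).symm x) = x
  /-- the operations of arity one are the multiples of the identity `Γ(1₀; )`, where `1₀` is the
  permutation of the empty set -/
  arity_one : Function.Bijective (fun c : K => c • comp (permSurj (1 : Equiv.Perm (Fin 0)))
    (fun j => j.elim0))

attribute [instance] Permutad.addCommGroup Permutad.module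

/-- `Γ(σ; μ, …, μ)` for a permutation `σ` and a binary operation `μ`. -/
def Permutad.compPerm {K : Type u} [CommRing K] (P : Permutad.{u, v} K) {n : ℕ}
    (σ : Equiv.Perm (Fin n)) (μ : P.obj 1) : P.obj n :=
  P.comp (permSurj σ) (fun j => castIdx (fibreCard_permSurj σ j).symm μ)

/-! ### Ideals and quotients -/

/-- Ideals of a permutad: submodules such that a composition with at least one entry in the
submodule is in the submodule. The identity operation is not to be identified with anything, so
that the quotient is a permutad. -/
structure Permutad.IsIdeal {K : Type u} [CommRing K] (P : Permutad.{u, v} K)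
    (I : ∀ n, Submodule K (P.obj n)) : Prop where
  comp_mem : ∀ {n k : ℕ} (t : Surj n k) (x : ∀ j : Fin k, P.obj (fibreCard t j)) (j : Fin k),
    x j ∈ I (fibreCard t j) → P.comp t x ∈ I n
  arity_one : I 0 = ⊥

theorem Permutad.IsIdeal.mk_comp_eq {K : Type u} [CommRing K] {P : Permutad.{u, v} K}
    {I : ∀ n, Submodule K (P.obj n)} (hI : P.IsIdeal I) {n k : ℕ} (t : Surj n k)
    (x y : ∀ j : Fin k, P.obj (fibreCard t j))
    (h : ∀ j, (I (fibreCard t j)).mkQ (x j) = (I (fibreCard t j)).mkQ (y j)) :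
    (I n).mkQ (P.comp t x) = (I n).mkQ (P.comp t y) := by
  classical
  have hd : ∀ j, (x - y) j ∈ I (fibreCard t j) := fun j => by
    simpa [Submodule.Quotient.eq] using h j
  have hx : x = (x - y) + y := by simp
  rw [hx, MultilinearMap.map_add_univ, map_sum,
    Finset.sum_eq_single_of_mem (∅ : Finset (Fin k)) (Finset.mem_univ _)]
  · simp
  · intro s _ hs
    obtain ⟨j, hj⟩ := Finset.nonempty_iff_ne_empty.2 hs
    rw [Submodule.mkQ_apply, Submodule.Quotient.mk_eq_zero]
    refine hI.comp_mem t _ j ?_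
    rw [Finset.piecewise_eq_of_mem _ _ _ hj]
    exact hd j

/-- A representative of an element of a quotient. -/
noncomputable def rep {K : Type u} [CommRing K] {M : Type v} [AddCommGroup M] [Module K M]
    (I : Submodule K M) (x : M ⧸ I) : M := Function.surjInv I.mkQ_surjective x

theorem mk_rep {K : Type u} [CommRing K] {M : Type v} [AddCommGroup M] [Module K M]
    (I : Submodule K M) (x : M ⧸ I) : I.mkQ (rep I x) = x :=
  Function.surjInv_eq I.mkQ_surjective x

/-- The composition in a quotient, computed on representatives. -/
noncomputable def Permutad.IsIdeal.quotientComp {K : Type u} [CommRing K] {P : Permutad.{u, v} K}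
    {I : ∀ n, Submodule K (P.obj n)} (hI : P.IsIdeal I) {n k : ℕ} (t : Surj n k) :
    MultilinearMap K (fun j : Fin k => P.obj (fibreCard t j) ⧸ I (fibreCard t j))
      (P.obj n ⧸ I n) where
  toFun x := (I n).mkQ (P.comp t (fun j => rep _ (x j)))
  map_update_add' := by
    intro inst x i a b
    have key : ∀ c : P.obj (fibreCard t i),
        (I n).mkQ (P.comp t (fun j => rep _ (Function.update x i ((I _).mkQ c) j))) =
        (I n).mkQ (P.comp t (Function.update (fun j => rep _ (x j)) i c)) := by
      intro c
      refine hI.mk_comp_eq t _ _ (fun j => ?_)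
      by_cases hj : j = i
      · subst hj; simp only [Function.update_self, mk_rep]
      · simp [hj]
    rw [← mk_rep _ a, ← mk_rep _ b, ← map_add, key, key, key, MultilinearMap.map_update_add,
      map_add]
  map_update_smul' := by
    intro inst x i c a
    have key : ∀ c : P.obj (fibreCard t i),
        (I n).mkQ (P.comp t (fun j => rep _ (Function.update x i ((I _).mkQ c) j))) =
        (I n).mkQ (P.comp t (Function.update (fun j => rep _ (x j)) i c)) := by
      intro c
      refine hI.mk_comp_eq t _ _ (fun j => ?_)
      by_cases hj : j = i
      · subst hj; simp only [Function.update_self, mk_rep]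
      · simp [hj]
    rw [← mk_rep _ a, ← map_smul, key, key, MultilinearMap.map_update_smul, map_smul]

theorem Permutad.IsIdeal.quotientComp_mk {K : Type u} [CommRing K] {P : Permutad.{u, v} K}
    {I : ∀ n, Submodule K (P.obj n)} (hI : P.IsIdeal I) {n k : ℕ} (t : Surj n k)
    (x : ∀ j : Fin k, P.obj (fibreCard t j)) :
    hI.quotientComp t (fun j => (I _).mkQ (x j)) = (I n).mkQ (P.comp t x) :=
  hI.mk_comp_eq t _ _ (fun _ => mk_rep _ _)

theorem castIdx_mkQ {K : Type u} [CommRing K] {P : Permutad.{u, v} K}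
    (I : ∀ n, Submodule K (P.obj n)) {m n : ℕ} (h : m = n) (x : P.obj m) :
    castIdx (A := fun n => P.obj n ⧸ I n) h ((I m).mkQ x) = (I n).mkQ (castIdx h x) := by
  subst h; rfl

/-- The quotient of a permutad by an ideal. -/
noncomputable def Permutad.quotient {K : Type u} [CommRing K] (P : Permutad.{u, v} K)
    (I : ∀ n, Submodule K (P.obj n)) (hI : P.IsIdeal I) : Permutad.{u, v} K where
  obj n := P.obj n ⧸ I n
  comp t := hI.quotientComp t
  assoc := by
    intro n k t m s x
    have hx : x = fun j i => (I _).mkQ (rep _ (x j i)) := by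
      funext j i; exact (mk_rep _ _).symm
    rw [hx]
    simp only [castIdx_mkQ, hI.quotientComp_mk, P.assoc]
  unit := by
    intro n hn x
    rw [← mk_rep _ x]
    simp only [castIdx_mkQ, hI.quotientComp_mk, P.unit]
  arity_one := by
    have h0 : ∀ c : K, (c • hI.quotientComp (permSurj (1 : Equiv.Perm (Fin 0)))
        (fun j => j.elim0) : P.obj 0 ⧸ I 0) =
        (I 0).mkQ (c • P.comp (permSurj (1 : Equiv.Perm (Fin 0))) (fun j => j.elim0)) := by
      intro c
      rw [map_smul, ← hI.quotientComp_mk]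
      congr 2
      funext j
      exact j.elim0
    have hb : Function.Bijective (I 0).mkQ := by
      refine ⟨?_, (I 0).mkQ_surjective⟩
      rw [← LinearMap.ker_eq_bot, Submodule.ker_mkQ, hI.arity_one]
    simp only [h0]
    exact hb.comp P.arity_one

/-- The ideal generated by a family of operations: the intersection of all ideals that contain
it. -/
def Permutad.idealSpan {K : Type u} [CommRing K] (P : Permutad.{u, v} K)
    (R : ∀ n, Set (P.obj n)) (n : ℕ) : Submodule K (P.obj n) :=
  sInf {J | ∃ I : ∀ n, Submodule K (P.obj n), P.IsIdeal I ∧ (∀ n, R n ⊆ I n) ∧ I n = J}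

theorem Permutad.mem_idealSpan {K : Type u} [CommRing K] (P : Permutad.{u, v} K)
    (R : ∀ n, Set (P.obj n)) (n : ℕ) (x : P.obj n) :
    x ∈ P.idealSpan R n ↔
      ∀ I : ∀ n, Submodule K (P.obj n), P.IsIdeal I → (∀ n, R n ⊆ I n) → x ∈ I n := by
  simp only [Permutad.idealSpan, Submodule.mem_sInf, Set.mem_ofPred_eq]
  constructor
  · intro h I hI hR
    exact h _ ⟨I, hI, hR, rfl⟩
  · rintro h J ⟨I, hI, hR, rfl⟩
    exact h I hI hR

theorem Permutad.isIdeal_idealSpan {K : Type u} [CommRing K] (P : Permutad.{u, v} K)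
    (R : ∀ n, Set (P.obj n)) (hR : R 0 = ∅) : P.IsIdeal (P.idealSpan R) where
  comp_mem := by
    intro n k t x j hx
    rw [P.mem_idealSpan] at hx ⊢
    intro I hI hRI
    exact hI.comp_mem t x j (hx I hI hRI)
  arity_one := by
    classical
    rw [eq_bot_iff]
    intro x hx
    rw [P.mem_idealSpan] at hx
    refine hx (fun n => if n = 0 then ⊥ else ⊤) ⟨?_, by simp⟩ ?_
    · intro n k t x j _
      obtain ⟨a, _⟩ := t.2 j
      have hn : n ≠ 0 := by rintro rfl; exact a.elim0
      simp [hn]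
    · intro n
      by_cases hn : n = 0
      · subst hn; simp [hR]
      · simp [hn]

/-! ### Free permutads -/

/-- Surjections with source an `n`-element set whose vertices are decorated by generators;
`X m` is the set of generators of arity `m + 1`. -/
structure Decorated (X : ℕ → Type) (n : ℕ) where
  /-- the number of vertices -/
  size : ℕ
  /-- the underlying surjection -/
  surj : Surj n size
  /-- the decoration of the vertices -/
  deco : ∀ j : Fin size, X (fibreCard surj j)

/-- Substitution of decorated surjections. -/
def Decorated.graft {X : ℕ → Type} {n k : ℕ} (t : Surj n k)
    (d : ∀ j : Fin k, Decorated X (fibreCard t j)) : Decorated X n where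
  size := ∑ j, (d j).size
  surj := t.subst (fun j => (d j).surj)
  deco w := castIdx (fibreCard_subst' t (fun j => (d j).surj) w)
    ((d (finSigmaFinEquiv.symm w).1).deco (finSigmaFinEquiv.symm w).2)

/-- The corolla decorated by a generator. -/
def Decorated.corolla {X : ℕ → Type} {n : ℕ} (hn : 0 < n) (x : X n) : Decorated X n where
  size := 1
  surj := Permutads.corolla n hn
  deco j := castIdx (fibreCard_corolla n hn j).symm x

/-- The decoration of the vertex to which `a` is sent. -/
def Decorated.decoAt {X : ℕ → Type} {n : ℕ} (d : Decorated X n) (a : Fin n) : Σ m, X m :=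
  ⟨fibreCard d.surj (d.surj a), d.deco (d.surj a)⟩

theorem sigma_castIdx {A : ℕ → Type v} {m n : ℕ} (h : m = n) (x : A m) :
    (⟨n, castIdx h x⟩ : Σ m, A m) = ⟨m, x⟩ := by
  subst h; rfl

theorem Surj.exists_orderIso {n k l : ℕ} (t : Surj n k) (s : Surj n l)
    (h : ∀ a b, t a ≤ t b ↔ s a ≤ s b) : ∃ e : Fin k ≃o Fin l, ∀ a, s a = e (t a) := by
  have heq : ∀ a b, t a = t b ↔ s a = s b := fun a b => by
    rw [le_antisymm_iff, le_antisymm_iff, h, h]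
  refine ⟨⟨⟨fun i => s (Function.surjInv t.2 i), fun i => t (Function.surjInv s.2 i), ?_, ?_⟩, ?_⟩,
    ?_⟩
  · intro i
    conv_rhs => rw [← Function.surjInv_eq t.2 i]
    rw [heq]
    exact Function.surjInv_eq s.2 _
  · intro i
    conv_rhs => rw [← Function.surjInv_eq s.2 i]
    rw [← heq]
    exact Function.surjInv_eq t.2 _
  · intro i j
    change s _ ≤ s _ ↔ _
    rw [← h, Function.surjInv_eq t.2, Function.surjInv_eq t.2]
  · intro a
    change s a = s _
    rw [← heq]
    exact (Function.surjInv_eq t.2 _).symm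

theorem Decorated.ext' {X : ℕ → Type} {n : ℕ} {d e : Decorated X n}
    (h : ∀ a b, d.surj a ≤ d.surj b ↔ e.surj a ≤ e.surj b)
    (hx : ∀ a, d.decoAt a = e.decoAt a) : d = e := by
  obtain ⟨k, t, x⟩ := d
  obtain ⟨l, s, y⟩ := e
  obtain ⟨f, hf⟩ := Surj.exists_orderIso t s h
  have hkl : k = l := by simpa using Fintype.card_congr f.toEquiv
  subst hkl
  have hts : t = s := by
    apply Subtype.ext
    funext a
    have : f = OrderIso.refl _ := Subsingleton.elim _ _
    exact ((hf a).trans (by rw [this]; rfl)).symm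
  subst hts
  have : x = y := by
    funext j
    obtain ⟨a, rfl⟩ := t.2 j
    exact eq_of_heq (Sigma.mk.inj (hx a)).2
  rw [this]

theorem finSigmaFinEquiv_lt_of_lt {k : ℕ} {m : Fin k → ℕ} {i j : Fin k} (h : i < j)
    (v : Fin (m i)) (w : Fin (m j)) :
    finSigmaFinEquiv (⟨i, v⟩ : (i : Fin k) × Fin (m i)) < finSigmaFinEquiv ⟨j, w⟩ := by
  rw [Fin.lt_def, finSigmaFinEquiv_apply, finSigmaFinEquiv_apply]
  dsimp only
  let f : ℕ → ℕ := fun l => if hl : l < k then m ⟨l, hl⟩ else 0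
  have hf : ∀ i : Fin k, ∑ l : Fin i.1, m (Fin.castLE i.2.le l) = ∑ l ∈ Finset.range i.1, f l := by
    intro i
    rw [← Fin.sum_univ_eq_sum_range]
    refine Finset.sum_congr rfl (fun l _ => ?_)
    have hl : l.1 < k := l.2.trans i.2
    simp only [f, hl, dite_true]
    rfl
  rw [hf, hf]
  have h1 : ∑ l ∈ Finset.range (i.1 + 1), f l ≤ ∑ l ∈ Finset.range j.1, f l :=
    Finset.sum_le_sum_of_subset (Finset.range_subset_range.2 h)
  rw [Finset.sum_range_succ] at h1
  have h2 : f i.1 = m i := by simp [f]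
  have h3 := v.2
  omega

theorem finSigmaFinEquiv_le_iff {k : ℕ} {m : Fin k → ℕ} {i : Fin k} (v w : Fin (m i)) :
    finSigmaFinEquiv (⟨i, v⟩ : (i : Fin k) × Fin (m i)) ≤ finSigmaFinEquiv ⟨i, w⟩ ↔ v ≤ w := by
  rw [Fin.le_def, finSigmaFinEquiv_apply, finSigmaFinEquiv_apply]
  simp

theorem substFun_le_iff {n k : ℕ} (t : Fin n → Fin k) {m : Fin k → ℕ}
    (s : ∀ j, Fin (fibreCard t j) → Fin (m j)) (a b : Fin n) :
    substFun t s a ≤ substFun t s b ↔ t a < t b ∨ ∃ h : t b = t a,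
      s (t a) (position t (t a) ⟨a, rfl⟩) ≤ s (t a) (position t (t a) ⟨b, h⟩) := by
  rcases lt_trichotomy (t a) (t b) with h | h | h
  · simp only [h, true_or, iff_true]
    exact (finSigmaFinEquiv_lt_of_lt h _ _).le
  · rw [substFun_eq t s b (t a) h.symm, substFun_eq t s a (t a) rfl, finSigmaFinEquiv_le_iff]
    simp [h]
  · constructor
    · intro h'
      exact absurd h' (not_le.2 (finSigmaFinEquiv_lt_of_lt h _ _))
    · rintro (h' | ⟨h', _⟩)
      · exact absurd h' h.asymm
      · exact absurd h' h.ne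

theorem position_substFun {n k : ℕ} (t : Fin n → Fin k) {m : Fin k → ℕ}
    (s : ∀ j, Fin (fibreCard t j) → Fin (m j)) (j : Fin k) (v : Fin (m j)) (a : Fin n)
    (ha : substFun t s a = finSigmaFinEquiv ⟨j, v⟩) (h : t a = j)
    (h' : s j (position t j ⟨a, h⟩) = v) :
    (position (substFun t s) (finSigmaFinEquiv ⟨j, v⟩) ⟨a, ha⟩).1 =
      (position (s j) v ⟨position t j ⟨a, h⟩, h'⟩).1 := by
  have : position (substFun t s) (finSigmaFinEquiv ⟨j, v⟩) =
      ((fibreSubst t s j v).trans (position (s j) v)).trans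
        (Fin.castOrderIso (fibreCard_subst t s j v).symm) := Subsingleton.elim _ _
  rw [this]
  rfl

theorem Decorated.graft_le_iff {X : ℕ → Type} {n k : ℕ} (t : Surj n k)
    (d : ∀ j : Fin k, Decorated X (fibreCard t j)) (a b : Fin n) :
    (graft t d).surj a ≤ (graft t d).surj b ↔ t a < t b ∨ ∃ h : t b = t a,
      (d (t a)).surj (position t (t a) ⟨a, rfl⟩) ≤
        (d (t a)).surj (position t (t a) ⟨b, h⟩) :=
  substFun_le_iff t (fun j => (d j).surj) a b

theorem Decorated.decoAt_graft {X : ℕ → Type} {n k : ℕ} (t : Surj n k)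
    (d : ∀ j : Fin k, Decorated X (fibreCard t j)) (a : Fin n) :
    (graft t d).decoAt a = (d (t a)).decoAt (position t (t a) ⟨a, rfl⟩) := by
  have key : ∀ (p : (j : Fin k) × Fin (d j).size),
      p = ⟨t a, (d (t a)).surj (position t (t a) ⟨a, rfl⟩)⟩ →
      (⟨_, (d p.1).deco p.2⟩ : Σ m, X m) =
        (d (t a)).decoAt (position t (t a) ⟨a, rfl⟩) := by
    rintro _ rfl
    rfl
  refine (sigma_castIdx _ _).trans (key _ ?_)
  exact (Equiv.symm_apply_eq finSigmaFinEquiv).2 rfl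

theorem Decorated.castIdx_le_iff {X : ℕ → Type} {m n : ℕ} (h : m = n) (d : Decorated X m)
    (a b : Fin n) (a' b' : Fin m) (ha : a.1 = a'.1) (hb : b.1 = b'.1) :
    (castIdx h d).surj a ≤ (castIdx h d).surj b ↔ d.surj a' ≤ d.surj b' := by
  subst h
  rw [Fin.ext ha, Fin.ext hb]
  rfl

theorem Decorated.decoAt_castIdx {X : ℕ → Type} {m n : ℕ} (h : m = n) (d : Decorated X m)
    (a : Fin n) (a' : Fin m) (ha : a.1 = a'.1) :
    (castIdx h d).decoAt a = d.decoAt a' := by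
  subst h
  rw [Fin.ext ha]
  rfl

theorem castIdx_sigma {A : ℕ → Type v} {k : ℕ} {m : Fin k → ℕ} {f : ∀ j, Fin (m j) → ℕ}
    (x : ∀ j i, A (f j i)) {N : ℕ} (j : Fin k) (i : Fin (m j)) (w : Fin (∑ j, m j))
    (hw : w = finSigmaFinEquiv ⟨j, i⟩)
    (h : f (finSigmaFinEquiv.symm w).1 (finSigmaFinEquiv.symm w).2 = N) :
    ∃ h' : f j i = N, castIdx h (x (finSigmaFinEquiv.symm w).1 (finSigmaFinEquiv.symm w).2) =
      castIdx h' (x j i) := by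
  have key : ∀ (p : (j : Fin k) × Fin (m j)), p = ⟨j, i⟩ → ∀ h : f p.1 p.2 = N,
      ∃ h' : f j i = N, castIdx h (x p.1 p.2) = castIdx h' (x j i) := by
    rintro _ rfl h
    exact ⟨h, rfl⟩
  exact key _ (by rw [hw, Equiv.symm_apply_apply]) h

theorem Decorated.graft_assoc {X : ℕ → Type} {n k : ℕ} (t : Surj n k) {m : Fin k → ℕ}
    (s : ∀ j, Surj (fibreCard t j) (m j))
    (x : ∀ (j : Fin k) (i : Fin (m j)), Decorated X (fibreCard (s j) i)) :
    graft t (fun j => graft (s j) (x j)) =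
      graft (t.subst s) (fun w => castIdx (fibreCard_subst' t s w)
        (x (finSigmaFinEquiv.symm w).1 (finSigmaFinEquiv.symm w).2)) := by
  have hsub : ∀ a, t.subst s a =
      finSigmaFinEquiv ⟨t a, s (t a) (position t (t a) ⟨a, rfl⟩)⟩ := fun a => rfl
  have hpos : ∀ (a b : Fin n) (hb : t.subst s b = t.subst s a) (h : t b = t a)
      (h' : s (t a) (position t (t a) ⟨b, h⟩) = s (t a) (position t (t a) ⟨a, rfl⟩)),
      (position (t.subst s) (t.subst s a) ⟨b, hb⟩).1 =
        (position (s (t a)) (s (t a) (position t (t a) ⟨a, rfl⟩))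
          ⟨position t (t a) ⟨b, h⟩, h'⟩).1 := fun a b hb h h' =>
    position_substFun t (fun j => s j) (t a) _ b hb h h'
  apply Decorated.ext'
  · intro a b
    rw [graft_le_iff, graft_le_iff]
    obtain ⟨hc, hx⟩ := castIdx_sigma x (t a) (s (t a) (position t (t a) ⟨a, rfl⟩))
      (t.subst s a) (hsub a) (fibreCard_subst' t s (t.subst s a))
    rw [hx]
    have hlt : t.subst s a < t.subst s b ↔ t a < t b ∨ ∃ h : t b = t a,
        s (t a) (position t (t a) ⟨a, rfl⟩) < s (t a) (position t (t a) ⟨b, h⟩) := by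
      rw [← not_le]
      have := substFun_le_iff t (fun j => s j) b a
      change t.subst s b ≤ t.subst s a ↔ _ at this
      rw [this]
      rcases lt_trichotomy (t a) (t b) with h | h | h
      · simp [h, h.ne, h.asymm]
      · have hb := substFun_eq t (fun j => s j) b (t a) h.symm
        have e : ∀ (j : Fin k) (h1 : t a = j) (h2 : t b = j),
            (s j (position t j ⟨b, h2⟩) ≤ s j (position t j ⟨a, h1⟩) ↔
             s (t a) (position t (t a) ⟨b, h.symm⟩) ≤ s (t a) (position t (t a) ⟨a, rfl⟩)) := by
          rintro _ rfl _
          rfl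
        simp [h, e]
      · simp [h, h.ne, h.asymm]
    have heq : t.subst s b = t.subst s a ↔ ∃ h : t b = t a,
        s (t a) (position t (t a) ⟨b, h⟩) = s (t a) (position t (t a) ⟨a, rfl⟩) :=
      substFun_eq_iff t (fun j => s j) b (t a) _
    constructor
    · rintro (h | ⟨h, h1⟩)
      · exact Or.inl (hlt.2 (Or.inl h))
      · rw [graft_le_iff] at h1
        rcases h1 with h1 | ⟨h1, h2⟩
        · exact Or.inl (hlt.2 (Or.inr ⟨h, h1⟩))
        · refine Or.inr ⟨heq.2 ⟨h, h1⟩, ?_⟩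
          rw [castIdx_le_iff hc _ _ _ _ _ (hpos a a rfl rfl rfl) (hpos a b _ h h1)]
          exact h2
    · rintro (h | ⟨h, h1⟩)
      · rcases hlt.1 h with h | ⟨h, h1⟩
        · exact Or.inl h
        · exact Or.inr ⟨h, (graft_le_iff _ _ _ _).2 (Or.inl h1)⟩
      · obtain ⟨h2, h3⟩ := heq.1 h
        refine Or.inr ⟨h2, (graft_le_iff _ _ _ _).2 (Or.inr ⟨h3, ?_⟩)⟩
        rw [castIdx_le_iff hc _ _ _ _ _ (hpos a a rfl rfl rfl) (hpos a b _ h2 h3)] at h1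
        exact h1
  · intro a
    rw [decoAt_graft, decoAt_graft, decoAt_graft]
    obtain ⟨hc, hx⟩ := castIdx_sigma x (t a) (s (t a) (position t (t a) ⟨a, rfl⟩))
      (t.subst s a) (hsub a) (fibreCard_subst' t s (t.subst s a))
    rw [hx]
    exact (decoAt_castIdx hc _ _ _ (hpos a a rfl rfl rfl)).symm

theorem Decorated.graft_corolla {X : ℕ → Type} {n : ℕ} (hn : 0 < n) (d : Decorated X n) :
    graft (Permutads.corolla n hn)
      (fun j => castIdx (fibreCard_corolla n hn j).symm d) = d := by
  have hpos : ∀ (j : Fin 1) (b : Fin n) (hb : Permutads.corolla n hn b = j),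
      (position (Permutads.corolla n hn) j ⟨b, hb⟩).1 = b.1 := by
    intro j b hb
    let e : Fin n ≃o Fibre (Permutads.corolla n hn) j :=
      { toFun := fun a => ⟨a, Subsingleton.elim _ _⟩
        invFun := fun a => a.1
        left_inv := fun _ => rfl
        right_inv := fun _ => rfl
        map_rel_iff' := Iff.rfl }
    have : position (Permutads.corolla n hn) j =
        e.symm.trans (Fin.castOrderIso (fibreCard_corolla n hn j).symm) := Subsingleton.elim _ _
    rw [this]
    rfl
  apply Decorated.ext'
  · intro a b
    rw [graft_le_iff]
    have h : Permutads.corolla n hn b = Permutads.corolla n hn a := rfl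
    have hle := castIdx_le_iff (fibreCard_corolla n hn (Permutads.corolla n hn a)).symm d _ _ a b
      (hpos (Permutads.corolla n hn a) a rfl) (hpos (Permutads.corolla n hn a) b h)
    constructor
    · rintro (h' | ⟨_, h'⟩)
      · exact absurd h' (lt_irrefl _)
      · exact hle.1 h'
    · exact fun h' => Or.inr ⟨h, hle.2 h'⟩
  · intro a
    rw [decoAt_graft]
    exact decoAt_castIdx _ d _ _ (hpos _ _ _)

/-- The term of a composition in the free permutad that corresponds to a choice of one decorated
surjection at each vertex. -/
noncomputable def freeTerm (K : Type u) [CommRing K] (X : ℕ → Type) {n k : ℕ} (t : Surj n k)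
    (d : ∀ j : Fin k, Decorated X (fibreCard t j)) :
    MultilinearMap K (fun j : Fin k => Decorated X (fibreCard t j) →₀ K)
      (Decorated X n →₀ K) :=
  (Finsupp.lsingle (Decorated.graft t d)).compMultilinearMap
    ((MultilinearMap.mkPiRing K (Fin k) (1 : K)).compLinearMap (fun j => Finsupp.lapply (d j)))

theorem freeTerm_apply (K : Type u) [CommRing K] (X : ℕ → Type) {n k : ℕ} (t : Surj n k)
    (d : ∀ j : Fin k, Decorated X (fibreCard t j))
    (f : ∀ j : Fin k, Decorated X (fibreCard t j) →₀ K) :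
    freeTerm K X t d f = Finsupp.single (Decorated.graft t d) (∏ j, f j (d j)) := by
  simp [freeTerm]

open Classical in
theorem sum_freeTerm (K : Type u) [CommRing K] (X : ℕ → Type) {n k : ℕ} (t : Surj n k)
    (f : ∀ j : Fin k, Decorated X (fibreCard t j) →₀ K)
    (S : ∀ j : Fin k, Finset (Decorated X (fibreCard t j))) (hS : ∀ j, (f j).support ⊆ S j) :
    ∑ d ∈ Fintype.piFinset (fun j => (f j).support), freeTerm K X t d f =
      ∑ d ∈ Fintype.piFinset S, freeTerm K X t d f := by
  refine Finset.sum_subset (Fintype.piFinset_subset _ _ hS) (fun d _ hd => ?_)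
  simp only [Fintype.mem_piFinset, not_forall, Finsupp.notMem_support_iff] at hd
  obtain ⟨j, hj⟩ := hd
  rw [freeTerm_apply, Finset.prod_eq_zero (Finset.mem_univ j) hj, Finsupp.single_zero]

open Classical in
/-- Composition in the free permutad: the multilinear extension of the substitution of decorated
surjections. -/
noncomputable def freeComp (K : Type u) [CommRing K] (X : ℕ → Type) {n k : ℕ} (t : Surj n k) :
    MultilinearMap K (fun j : Fin k => Decorated X (fibreCard t j) →₀ K)
      (Decorated X n →₀ K) where
  toFun f := ∑ d ∈ Fintype.piFinset (fun j => (f j).support), freeTerm K X t d f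
  map_update_add' := by
    intro inst f i a b
    let S : ∀ j, Finset (Decorated X (fibreCard t j)) := fun j =>
      (Function.update f i a j).support ∪ (Function.update f i b j).support ∪
        (Function.update f i (a + b) j).support
    rw [sum_freeTerm K X t _ S (fun j => Finset.subset_union_right),
      sum_freeTerm K X t (Function.update f i a) S
        (fun j => Finset.subset_union_left.trans Finset.subset_union_left),
      sum_freeTerm K X t (Function.update f i b) S
        (fun j => Finset.subset_union_right.trans Finset.subset_union_left),
      ← Finset.sum_add_distrib]
    exact Finset.sum_congr rfl (fun d _ => (freeTerm K X t d).map_update_add f i a b)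
  map_update_smul' := by
    intro inst f i c a
    let S : ∀ j, Finset (Decorated X (fibreCard t j)) := fun j =>
      (Function.update f i a j).support ∪ (Function.update f i (c • a) j).support
    rw [sum_freeTerm K X t _ S (fun j => Finset.subset_union_right),
      sum_freeTerm K X t (Function.update f i a) S (fun j => Finset.subset_union_left),
      Finset.smul_sum]
    exact Finset.sum_congr rfl (fun d _ => (freeTerm K X t d).map_update_smul f i c a)

theorem freeComp_single (K : Type u) [CommRing K] (X : ℕ → Type) {n k : ℕ} (t : Surj n k)
    (d : ∀ j : Fin k, Decorated X (fibreCard t j)) :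
    freeComp K X t (fun j => Finsupp.single (d j) 1) =
      Finsupp.single (Decorated.graft t d) 1 := by
  classical
  have h := sum_freeTerm K X t (fun j => Finsupp.single (d j) 1) (fun j => {d j})
    (fun j => Finsupp.support_single_subset)
  refine Eq.trans ?_ (h.trans ?_)
  · change Finset.sum _ _ = Finset.sum _ _
    congr!
  · rw [Fintype.piFinset_singleton, Finset.sum_singleton, freeTerm_apply]
    simp

theorem castIdx_single {K : Type u} [CommRing K] {X : ℕ → Type} {m n : ℕ} (h : m = n)
    (d : Decorated X m) (c : K) :
    castIdx (A := fun n => Decorated X n →₀ K) h (Finsupp.single d c) =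
      Finsupp.single (castIdx h d) c := by
  subst h; rfl

theorem castIdx_add {A : ℕ → Type v} [∀ n, AddCommGroup (A n)] {m n : ℕ} (h : m = n)
    (x y : A m) : castIdx h (x + y) = castIdx h x + castIdx h y := by
  subst h; rfl

theorem castIdx_smul {K : Type u} [CommRing K] {A : ℕ → Type v} [∀ n, AddCommGroup (A n)]
    [∀ n, Module K (A n)] {m n : ℕ} (h : m = n) (c : K) (x : A m) :
    castIdx h (c • x) = c • castIdx h x := by
  subst h; rfl

theorem freeComp_assoc (K : Type u) [CommRing K] (X : ℕ → Type) {n k : ℕ} (t : Surj n k)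
    {m : Fin k → ℕ} (s : ∀ j, Surj (fibreCard t j) (m j))
    (x : ∀ (j : Fin k) (i : Fin (m j)), Decorated X (fibreCard (s j) i) →₀ K) :
    freeComp K X t (fun j => freeComp K X (s j) (x j)) =
      freeComp K X (t.subst s) (fun w =>
        castIdx (A := fun n => Decorated X n →₀ K) (fibreCard_subst' t s w)
          (x (finSigmaFinEquiv.symm w).1 (finSigmaFinEquiv.symm w).2)) := by
  have hu1 : ∀ [DecidableEq (Σ j : Fin k, Fin (m j))]
      (y : ∀ p : Σ j : Fin k, Fin (m j), Decorated X (fibreCard (s p.1) p.2) →₀ K)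
      (p : Σ j : Fin k, Fin (m j)) (a : Decorated X (fibreCard (s p.1) p.2) →₀ K),
      (fun j => freeComp K X (s j) (fun i => Function.update y p a ⟨j, i⟩)) =
        Function.update (fun j => freeComp K X (s j) (fun i => y ⟨j, i⟩)) p.1
          (freeComp K X (s p.1) (Function.update (fun i => y ⟨p.1, i⟩) p.2 a)) := by
    rintro _ y ⟨j₀, i₀⟩ a
    funext j
    by_cases hj : j = j₀
    · subst hj
      simp only [Function.update_self]
      congr 1
      funext i
      by_cases hi : i = i₀
      · subst hi; simp
      · rw [Function.update_of_ne hi, Function.update_of_ne]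
        simpa using hi
    · rw [Function.update_of_ne hj]
      congr 1
      funext i
      rw [Function.update_of_ne]
      simp [hj]
  have hu2 : ∀ [DecidableEq (Σ j : Fin k, Fin (m j))]
      (y : ∀ p : Σ j : Fin k, Fin (m j), Decorated X (fibreCard (s p.1) p.2) →₀ K)
      (p : Σ j : Fin k, Fin (m j)),
      ∃ h : fibreCard (s p.1) p.2 = fibreCard (t.subst s) (finSigmaFinEquiv p),
      ∀ (a : Decorated X (fibreCard (s p.1) p.2) →₀ K),
      (fun w => castIdx (A := fun n => Decorated X n →₀ K) (fibreCard_subst' t s w)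
          (Function.update y p a (finSigmaFinEquiv.symm w))) =
        Function.update (fun w => castIdx (A := fun n => Decorated X n →₀ K)
          (fibreCard_subst' t s w) (y (finSigmaFinEquiv.symm w))) (finSigmaFinEquiv p)
          (castIdx (A := fun n => Decorated X n →₀ K) h a) := by
    intro _ y p
    refine ⟨(fibreCard_subst t (fun j => s j) p.1 p.2).symm, fun a => ?_⟩
    funext w
    by_cases hw : w = finSigmaFinEquiv p
    · subst hw
      rw [Function.update_self]
      have key : ∀ (p' : Σ j : Fin k, Fin (m j)), p' = p →
          ∀ (h : fibreCard (s p'.1) p'.2 = fibreCard (t.subst s) (finSigmaFinEquiv p)) h',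
          castIdx (A := fun n => Decorated X n →₀ K) h (Function.update y p a p') =
            castIdx (A := fun n => Decorated X n →₀ K) h' a := by
        rintro _ rfl h h'
        rw [Function.update_self]
      exact key _ (Equiv.symm_apply_apply _ _) _ _
    · rw [Function.update_of_ne hw, Function.update_of_ne]
      rwa [Ne, Equiv.symm_apply_eq]
  let F : MultilinearMap K
      (fun p : Σ j : Fin k, Fin (m j) => Decorated X (fibreCard (s p.1) p.2) →₀ K)
      (Decorated X n →₀ K) :=
    { toFun := fun y => freeComp K X t (fun j => freeComp K X (s j) (fun i => y ⟨j, i⟩))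
      map_update_add' := by
        intro _ y p a b
        simp only [hu1, MultilinearMap.map_update_add]
      map_update_smul' := by
        intro _ y p c a
        simp only [hu1, MultilinearMap.map_update_smul] }
  let G : MultilinearMap K
      (fun p : Σ j : Fin k, Fin (m j) => Decorated X (fibreCard (s p.1) p.2) →₀ K)
      (Decorated X n →₀ K) :=
    { toFun := fun y => freeComp K X (t.subst s) (fun w =>
        castIdx (A := fun n => Decorated X n →₀ K) (fibreCard_subst' t s w)
          (y (finSigmaFinEquiv.symm w)))
      map_update_add' := by
        intro _ y p a b
        obtain ⟨h, hu⟩ := hu2 y p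
        rw [hu, hu, hu, castIdx_add, MultilinearMap.map_update_add]
      map_update_smul' := by
        intro _ y p c a
        obtain ⟨h, hu⟩ := hu2 y p
        rw [hu, hu, castIdx_smul, MultilinearMap.map_update_smul] }
  have hFG : F = G := by
    refine Module.Basis.ext_multilinear (fun _ => Finsupp.basisSingleOne) (fun d => ?_)
    simp only [Finsupp.coe_basisSingleOne]
    change freeComp K X t (fun j => freeComp K X (s j) (fun i => Finsupp.single (d ⟨j, i⟩) 1)) =
      freeComp K X (t.subst s) (fun w =>
        castIdx (A := fun n => Decorated X n →₀ K) (fibreCard_subst' t s w)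
          (Finsupp.single (d (finSigmaFinEquiv.symm w)) 1))
    simp only [freeComp_single, castIdx_single]
    rw [Decorated.graft_assoc]
  exact congrArg (fun H => H (fun p => x p.1 p.2)) hFG

theorem freeComp_corolla (K : Type u) [CommRing K] (X : ℕ → Type) (n : ℕ) (hn : 0 < n)
    (x : Decorated X n →₀ K) :
    freeComp K X (corolla n hn) (fun j =>
      castIdx (A := fun n => Decorated X n →₀ K) (fibreCard_corolla n hn j).symm x) = x := by
  have hu : ∀ x : Decorated X n →₀ K, (fun j : Fin 1 =>
      castIdx (A := fun n => Decorated X n →₀ K) (fibreCard_corolla n hn j).symm x) =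
      Function.update (fun _ => 0) 0
        (castIdx (A := fun n => Decorated X n →₀ K) (fibreCard_corolla n hn 0).symm x) := by
    intro x
    funext j
    have hj : j = 0 := Subsingleton.elim _ _
    subst hj
    rw [Function.update_self]
  let F : (Decorated X n →₀ K) →ₗ[K] (Decorated X n →₀ K) :=
    { toFun := fun x => freeComp K X (corolla n hn) (fun j =>
        castIdx (A := fun n => Decorated X n →₀ K) (fibreCard_corolla n hn j).symm x)
      map_add' := by
        intro x y
        rw [hu, hu, hu, castIdx_add, MultilinearMap.map_update_add]
      map_smul' := by
        intro c x
        rw [hu, hu, castIdx_smul, MultilinearMap.map_update_smul, RingHom.id_apply] }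
  have hF : F = LinearMap.id := by
    refine Finsupp.basisSingleOne.ext (fun d => ?_)
    simp only [Finsupp.coe_basisSingleOne, LinearMap.id_apply]
    change freeComp K X (corolla n hn) (fun j => castIdx (A := fun n => Decorated X n →₀ K)
      (fibreCard_corolla n hn j).symm (Finsupp.single d 1)) = _
    simp only [castIdx_single, freeComp_single, Decorated.graft_corolla]
  exact LinearMap.congr_fun hF x

/-- The free permutad on a family of generators, `X m` being the set of generators of arity
`m + 1`: if `M` is the arity-graded module with basis `X`, the direct sum over all surjections `t`
of the tensor products `M_t` has the surjections decorated by `X` as a basis. -/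
noncomputable def free (K : Type u) [CommRing K] (X : ℕ → Type) : Permutad.{u, u} K where
  obj n := Decorated X n →₀ K
  comp t := freeComp K X t
  assoc t _ s x := freeComp_assoc K X t s x
  unit n hn x := freeComp_corolla K X n hn x
  arity_one := by
    have hsub : ∀ d e : Decorated X 0, d = e := fun d e =>
      Decorated.ext' (fun a => a.elim0) (fun a => a.elim0)
    let d₀ : Decorated X 0 := Decorated.graft (permSurj (1 : Equiv.Perm (Fin 0)))
      (fun j => j.elim0)
    have h : ∀ c : K, c • freeComp K X (permSurj (1 : Equiv.Perm (Fin 0))) (fun j => j.elim0) =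
        Finsupp.single d₀ c := by
      intro c
      have h1 := freeComp_single K X (permSurj (1 : Equiv.Perm (Fin 0))) (fun j => j.elim0)
      have h2 : (fun j : Fin 0 => Finsupp.single
          ((fun j => j.elim0 : ∀ j : Fin 0, Decorated X
            (fibreCard (permSurj (1 : Equiv.Perm (Fin 0))) j)) j) (1 : K)) =
          fun j => j.elim0 := funext (fun j => j.elim0)
      rw [← h2, h1, Finsupp.smul_single, smul_eq_mul, mul_one]
    simp only [h]
    refine ⟨Finsupp.single_injective d₀, fun x => ⟨x d₀, ?_⟩⟩
    ext e
    rw [hsub e d₀, Finsupp.single_eq_same]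

/-- A generator, as an operation of the free permutad. -/
noncomputable def free.of (K : Type u) [CommRing K] {X : ℕ → Type} {n : ℕ} (hn : 0 < n)
    (x : X n) : (free K X).obj n :=
  Finsupp.single (Decorated.corolla hn x) (1 : K)

/-! ### The parametrized associative permutad -/

/-- A single generator, of arity two. -/
def BinaryGen (m : ℕ) : Type := PLift (m = 1)

/-- The generating binary operation of the free permutad on one binary operation. -/
noncomputable def freeMu (K : Type u) [CommRing K] : (free K BinaryGen).obj 1 :=
  free.of K one_pos (⟨rfl⟩ : BinaryGen 1)

/-- The relation `Γ((12); μ, μ) - q Γ(1₂; μ, μ)`, an operation of arity three. -/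
noncomputable def relator (K : Type u) [CommRing K] (q : K) : (free K BinaryGen).obj 2 :=
  (free K BinaryGen).compPerm (Equiv.swap (0 : Fin 2) 1) (freeMu K) -
    q • (free K BinaryGen).compPerm (1 : Equiv.Perm (Fin 2)) (freeMu K)

/-- The defining relations: only the one above. -/
def relations (K : Type u) [CommRing K] (q : K) : ∀ n, Set ((free K BinaryGen).obj n)
  | 2 => {relator K q}
  | _ => ∅

/-- The permutad `q`-permAs: generated by one binary operation `μ`, with the relation
`Γ((12); μ, μ) = q Γ(1₂; μ, μ)`, i.e. `μ ∘₂ μ = q μ ∘₁ μ`. -/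
noncomputable def qPermAs (K : Type u) [CommRing K] (q : K) : Permutad.{u, u} K :=
  (free K BinaryGen).quotient ((free K BinaryGen).idealSpan (relations K q))
    ((free K BinaryGen).isIdeal_idealSpan (relations K q) rfl)

/-- The generating binary operation of `q`-permAs. -/
noncomputable def mu (K : Type u) [CommRing K] (q : K) : (qPermAs K q).obj 1 :=
  ((free K BinaryGen).idealSpan (relations K q) 1).mkQ (freeMu K)

/-! ### Coxeter length -/

/-- The Coxeter length of a permutation: the least number of factors in an expression of it as a
product of adjacent transpositions. -/
noncomputable def coxeterLength {n : ℕ} (σ : Equiv.Perm (Fin n)) : ℕ :=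
  sInf {r | ∃ w : List (Equiv.Perm (Fin n)), w.length = r ∧
    (∀ s ∈ w, ∃ i j : Fin n, i.1 + 1 = j.1 ∧ s = Equiv.swap i j) ∧ w.prod = σ}

end Permutads

namespace Permutads

universe u v

/-! ### Inversions -/

/-! A vertex carrying the binary generator has a one-element fibre, so the free permutad on `μ` has
in degree `n` the basis of all permutations of `Fin n`. Two facts about inversions then determine
the quotient, over any commutative ring and without a rewriting argument.

Lower bound: inversions are additive under substitution (`inv_substFun`). Hence the linear form `σ ↦
q ^ inv σ` is multiplicative up to the factor `q ^ inv t` (`invForm_freeComp`), and its kernels form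
an ideal. The relator lies in this ideal, so the form vanishes on the generated ideal; as it takes
the value `1` on the identity permutation, no nonzero multiple of `Γ(1ₙ; μ, …, μ)` is killed.

Upper bound: suppose the value `i + 1` occurs before `i` in `σ`. Gluing these two values gives a
surjection with one two-element fibre. Substituting there the reversal recovers `σ`, and
substituting the identity gives `s_i σ`. Substituting the relator therefore yields `Γ(σ) - q Γ(s_i
σ)` (`compPerm_sub_mem_of_descent`). Removing descents one by one reduces every `σ` to the identity,
at the cost of one factor `q` per inversion (`mkQ_compPerm`).

The same gluing, with additivity, shows that a descent accounts for exactly one inversion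
(`inv_of_descent`), whence Coxeter length is the inversion number. -/

/-- The number of inversions of a map between linearly ordered sets. -/
def inv {α β : Type*} [Fintype α] [LinearOrder α] [LinearOrder β] (f : α → β) : ℕ :=
  (Finset.univ.filter (fun p : α × α => p.1 < p.2 ∧ f p.2 < f p.1)).card

theorem inv_eq_zero_of_monotone {α β : Type*} [Fintype α] [LinearOrder α] [LinearOrder β]
    {f : α → β} (hf : Monotone f) : inv f = 0 := by
  rw [inv, Finset.card_eq_zero, Finset.filter_eq_empty_iff]
  rintro p - ⟨h, h'⟩
  exact absurd h' (not_lt.2 (hf h.le))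

/-- Quantifying over the common vertex `j` makes the condition symmetric in `a` and `b`, so that
inversions inside fibres can be sorted by vertex. -/
theorem substFun_lt_iff {n k : ℕ} (t : Fin n → Fin k) {m : Fin k → ℕ}
    (s : ∀ j, Fin (fibreCard t j) → Fin (m j)) (a b : Fin n) :
    substFun t s b < substFun t s a ↔ t b < t a ∨ ∃ (j : Fin k) (ha : t a = j) (hb : t b = j),
      s j (position t j ⟨b, hb⟩) < s j (position t j ⟨a, ha⟩) := by
  rw [← not_le, substFun_le_iff]
  rcases lt_trichotomy (t a) (t b) with h | h | h
  · simp only [h, true_or, not_true, false_iff, not_or, not_exists, h.asymm, not_false_iff, true_and]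
    rintro j rfl hb
    exact absurd hb h.ne'
  · constructor
    · intro h'
      exact Or.inr ⟨t a, rfl, h.symm, not_le.1 (fun hle => h' (Or.inr ⟨h.symm, hle⟩))⟩
    · rintro (h' | ⟨j, rfl, hb, h'⟩) (h'' | ⟨_, h''⟩)
      · exact h'.asymm h''
      · exact h'.ne h.symm
      · exact h''.ne h
      · exact h''.not_gt h'
  · simp [h, h.asymm, h.ne]

/-- A pair is inverted by the substitution either because `t` inverts it, or because it lies in one
fibre of `t` and the map substituted there inverts its positions. Positions are increasing in the
fibre, so the second kind is counted by the `inv (s j)`. -/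
theorem inv_substFun {n k : ℕ} (t : Fin n → Fin k) {m : Fin k → ℕ}
    (s : ∀ j, Fin (fibreCard t j) → Fin (m j)) :
    inv (substFun t s) = inv t + ∑ j, inv (s j) := by
  classical
  -- `A j` consists of the inversions of `s j`, carried back to the fibre over `j` inside `Fin n`.
  let A : ∀ j, Finset (Fin n × Fin n) := fun j =>
    (Finset.univ.filter (fun p : Fin (fibreCard t j) × Fin (fibreCard t j) =>
      p.1 < p.2 ∧ s j p.2 < s j p.1)).map
      (((position t j).symm.toEquiv.toEmbedding.trans
        (Function.Embedding.subtype _)).prodMap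
        ((position t j).symm.toEquiv.toEmbedding.trans (Function.Embedding.subtype _)))
  have hA : ∀ j p, p ∈ A j ↔ p.1 < p.2 ∧ ∃ (ha : t p.1 = j) (hb : t p.2 = j),
      s j (position t j ⟨p.2, hb⟩) < s j (position t j ⟨p.1, ha⟩) := by
    rintro j ⟨a, b⟩
    simp only [A, Finset.mem_map, Finset.mem_filter, Finset.mem_univ, true_and]
    constructor
    · rintro ⟨⟨x, y⟩, ⟨h1, h2⟩, h⟩
      obtain ⟨rfl, rfl⟩ := Prod.mk.inj h
      refine ⟨(position t j).symm.lt_iff_lt.2 h1, ((position t j).symm x).2,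
        ((position t j).symm y).2, ?_⟩
      simpa using h2
    · rintro ⟨h1, ha, hb, h2⟩
      refine ⟨(position t j ⟨a, ha⟩, position t j ⟨b, hb⟩), ⟨?_, h2⟩, ?_⟩
      · exact (position t j).lt_iff_lt.2 h1
      · simp
  have hcard : ∀ j, (A j).card = inv (s j) := fun j => Finset.card_map _
  have hdisj : (↑(Finset.univ : Finset (Fin k)) : Set (Fin k)).PairwiseDisjoint A := by
    intro i _ j _ hij
    refine Finset.disjoint_left.2 (fun p hp hp' => hij ?_)
    obtain ⟨_, hi, _⟩ := (hA i p).1 hp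
    obtain ⟨_, hj, _⟩ := (hA j p).1 hp'
    exact hi.symm.trans hj
  have hunion : Finset.univ.filter (fun p : Fin n × Fin n =>
        p.1 < p.2 ∧ substFun t s p.2 < substFun t s p.1) =
      Finset.univ.filter (fun p : Fin n × Fin n => p.1 < p.2 ∧ t p.2 < t p.1) ∪
        Finset.univ.biUnion A := by
    ext p
    simp only [Finset.mem_union, Finset.mem_biUnion, hA, Finset.mem_filter, Finset.mem_univ,
      true_and, substFun_lt_iff, and_or_left, exists_and_left]
  rw [inv, hunion, Finset.card_union_of_disjoint, Finset.card_biUnion hdisj]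
  · simp only [hcard]; rfl
  · refine Finset.disjoint_left.2 (fun p hp hp' => ?_)
    simp only [Finset.mem_biUnion, hA] at hp'
    obtain ⟨j, _, _, ha, hb, _⟩ := hp'
    have := (Finset.mem_filter.1 hp).2.2
    rw [ha, hb] at this
    exact lt_irrefl _ this

/-! ### The basis of permutations of the free permutad on a binary operation -/

/-- A permutation, all of whose vertices are decorated by the binary generator. -/
def Decorated.ofPerm {n : ℕ} (σ : Equiv.Perm (Fin n)) : Decorated BinaryGen n where
  size := n
  surj := permSurj σ
  deco j := ⟨fibreCard_permSurj σ j⟩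

/-- There is a single generator, so decorations carry no information and a decorated surjection is
determined by the preorder it induces on its source. -/
theorem BinaryGen.sigma_ext (x y : Σ m, BinaryGen m) : x = y := by
  obtain ⟨m, ⟨rfl⟩⟩ := x
  obtain ⟨l, ⟨rfl⟩⟩ := y
  rfl

theorem Decorated.binary_ext {n : ℕ} {d e : Decorated BinaryGen n}
    (h : ∀ a b, d.surj a ≤ d.surj b ↔ e.surj a ≤ e.surj b) : d = e :=
  Decorated.ext' h (fun _ => BinaryGen.sigma_ext _ _)

/-- A decoration of a vertex is a proof that its fibre has one element. -/
theorem Decorated.surj_injective {n : ℕ} (d : Decorated BinaryGen n) :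
    Function.Injective d.surj := by
  intro a b h
  have h1 : Fintype.card (Fibre d.surj (d.surj b)) = 1 := (d.deco (d.surj b)).down
  obtain ⟨x, hx⟩ := Fintype.card_eq_one_iff.1 h1
  exact congrArg Subtype.val ((hx ⟨a, h⟩).trans (hx ⟨b, rfl⟩).symm)

theorem Decorated.exists_eq_ofPerm {n : ℕ} (d : Decorated BinaryGen n) :
    ∃ σ : Equiv.Perm (Fin n), d = ofPerm σ := by
  have hb : Function.Bijective d.surj := ⟨d.surj_injective, d.surj.2⟩
  have hs : d.size = n := by simpa using (Fintype.card_of_bijective hb).symm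
  refine ⟨(Equiv.ofBijective _ hb).trans (finCongr hs), Decorated.binary_ext (fun a b => ?_)⟩
  rfl

theorem freeMu_eq (K : Type u) [CommRing K] :
    freeMu K = Finsupp.single (Decorated.ofPerm (1 : Equiv.Perm (Fin 1))) (1 : K) := by
  change Finsupp.single _ _ = _
  congr 1
  exact Decorated.binary_ext (fun a b => by simp [Subsingleton.elim a b])

/-- All fibres are singletons, so what is substituted cannot affect the order. -/
theorem graft_ofPerm {n : ℕ} (σ : Equiv.Perm (Fin n))
    (d : ∀ j, Decorated BinaryGen (fibreCard (permSurj σ) j)) :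
    Decorated.graft (permSurj σ) d = Decorated.ofPerm σ := by
  refine Decorated.binary_ext (fun a b => ?_)
  rw [Decorated.graft_le_iff]
  change σ a < σ b ∨ _ ↔ σ a ≤ σ b
  rw [le_iff_lt_or_eq]
  refine or_congr_right ⟨fun h => h.1.symm, fun h => ?_⟩
  obtain rfl := σ.injective h
  exact ⟨rfl, le_rfl⟩

theorem free_compPerm (K : Type u) [CommRing K] {n : ℕ} (σ : Equiv.Perm (Fin n)) :
    (free K BinaryGen).compPerm σ (freeMu K) =
      Finsupp.single (Decorated.ofPerm σ) (1 : K) := by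
  rw [freeMu_eq]
  change freeComp K BinaryGen (permSurj σ) (fun j => castIdx (A := fun n => Decorated _ n →₀ K) _
    (Finsupp.single _ _)) = _
  simp only [castIdx_single, freeComp_single, graft_ofPerm]

/-! ### The functional counting inversions -/

/-- The linear form on the free permutad on one binary operation that sends a permutation to
`q` to the power of its number of inversions. -/
noncomputable def invForm (K : Type u) [CommRing K] (q : K) (n : ℕ) :
    (Decorated BinaryGen n →₀ K) →ₗ[K] K :=
  Finsupp.linearCombination K (fun d => q ^ inv d.surj)

theorem invForm_single (K : Type u) [CommRing K] (q : K) {n : ℕ} (d : Decorated BinaryGen n)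
    (c : K) : invForm K q n (Finsupp.single d c) = c * q ^ inv d.surj := by
  simp [invForm]

theorem inv_graft {X : ℕ → Type} {n k : ℕ} (t : Surj n k)
    (d : ∀ j : Fin k, Decorated X (fibreCard t j)) :
    inv (Decorated.graft t d).surj = inv t + ∑ j, inv (d j).surj :=
  inv_substFun t (fun j => (d j).surj)

/-- Both sides are multilinear, and on basis elements this is additivity of inversions. -/
theorem invForm_freeComp (K : Type u) [CommRing K] (q : K) {n k : ℕ} (t : Surj n k)
    (x : ∀ j : Fin k, Decorated BinaryGen (fibreCard t j) →₀ K) :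
    invForm K q n (freeComp K BinaryGen t x) =
      q ^ inv t * ∏ j, invForm K q (fibreCard t j) (x j) := by
  have h : (invForm K q n).compMultilinearMap (freeComp K BinaryGen t) =
      (q ^ inv t) • (MultilinearMap.mkPiRing K (Fin k) (1 : K)).compLinearMap
        (fun j => invForm K q (fibreCard t j)) := by
    refine Module.Basis.ext_multilinear (fun _ => Finsupp.basisSingleOne) (fun d => ?_)
    simp only [Finsupp.coe_basisSingleOne, LinearMap.compMultilinearMap_apply, freeComp_single,
      invForm_single, inv_graft, smul_apply, MultilinearMap.compLinearMap_apply,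
      MultilinearMap.mkPiRing_apply, one_mul, smul_eq_mul, mul_one, pow_add,
      Finset.prod_pow_eq_pow_sum]
  simpa using congrArg (fun F => F x) h

/-- The product formula vanishes as soon as one factor does. On operations of arity one the form is
injective, since it sends the only basis element to `1`. -/
theorem isIdeal_ker_invForm (K : Type u) [CommRing K] (q : K) :
    (free K BinaryGen).IsIdeal (fun n => LinearMap.ker (invForm K q n)) where
  comp_mem := by
    intro n k t x j hx
    refine (invForm_freeComp K q t x).trans ?_
    rw [Finset.prod_eq_zero (Finset.mem_univ j) (LinearMap.mem_ker.1 hx), mul_zero]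
  arity_one := by
    refine eq_bot_iff.2 (fun (x : Decorated BinaryGen 0 →₀ K) hx => ?_)
    change invForm K q 0 x = 0 at hx
    change x = 0
    have hd : ∀ d : Decorated BinaryGen 0, d = Decorated.ofPerm 1 := fun d =>
      Decorated.binary_ext (fun a => a.elim0)
    have hx' : x = Finsupp.single (Decorated.ofPerm 1) (x (Decorated.ofPerm 1)) := by
      refine Finsupp.ext (fun d => ?_)
      rw [hd d, Finsupp.single_eq_same]
    rw [hx', invForm_single, inv_eq_zero_of_monotone (fun a => a.elim0)] at hx
    rw [hx']
    simpa using hx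

/-! ### Adjacent transpositions -/

/-- `i.predAbove` is the monotone surjection gluing `i.castSucc` to `i.succ`; the fibre over `i` is
its only fibre with more than one element. -/
theorem predAbove_eq_self_iff {m : ℕ} (i : Fin m) (x : Fin (m + 1)) :
    i.predAbove x = i ↔ x = i.castSucc ∨ x = i.succ := by
  constructor
  · intro h
    rcases le_or_gt x i.castSucc with hx | hx
    · rw [Fin.predAbove_of_le_castSucc _ _ hx] at h
      exact Or.inl (by rw [← h, Fin.castSucc_castPred])
    · rw [Fin.predAbove_of_castSucc_lt _ _ hx] at h
      exact Or.inr (by rw [← h, Fin.succ_pred])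
  · rintro (rfl | rfl)
    · exact Fin.predAbove_castSucc_self i
    · exact Fin.predAbove_succ_self i

theorem eq_of_predAbove_eq {m : ℕ} {i : Fin m} {x y : Fin (m + 1)}
    (h : i.predAbove x = i.predAbove y) (hx : i.predAbove x ≠ i) : x = y := by
  have hy := h ▸ hx
  rw [Ne, predAbove_eq_self_iff, not_or] at hx hy
  simp only [Fin.predAbove, Fin.ext_iff, Fin.lt_def] at h hx hy ⊢
  simp only [Fin.val_castSucc, Fin.val_succ] at h hx hy
  split_ifs at h <;> simp at h <;> omega

/-! ### Gluing two adjacent values of a permutation -/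

/-- The surjection obtained from a permutation by identifying two adjacent values. -/
def collapse {m : ℕ} (σ : Equiv.Perm (Fin (m + 1))) (i : Fin m) : Surj (m + 1) m :=
  ⟨fun a => i.predAbove (σ a), (Fin.predAbove_surjective i).comp σ.surjective⟩

theorem fibreCard_collapse {m : ℕ} (σ : Equiv.Perm (Fin (m + 1))) (i : Fin m) :
    fibreCard (collapse σ i) i = 2 := by
  have e : Fibre (collapse σ i) i ≃ {x : Fin (m + 1) // x ∈ ({i.castSucc, i.succ} : Finset _)} :=
    σ.subtypeEquiv (fun a => by
      simp only [Finset.mem_insert, Finset.mem_singleton]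
      exact predAbove_eq_self_iff i (σ a))
  rw [fibreCard, Fintype.card_congr e, Fintype.card_coe, Finset.card_pair]
  exact (Fin.castSucc_lt_succ).ne

theorem collapse_swap_mul {m : ℕ} (σ : Equiv.Perm (Fin (m + 1))) (i : Fin m) :
    collapse (Equiv.swap i.castSucc i.succ * σ) i = collapse σ i := by
  refine Subtype.ext (funext (fun a => ?_))
  change i.predAbove (Equiv.swap i.castSucc i.succ (σ a)) = i.predAbove (σ a)
  rcases eq_or_ne (σ a) i.castSucc with h | h
  · simp [h]
  rcases eq_or_ne (σ a) i.succ with h' | h'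
  · simp [h']
  rw [Equiv.swap_apply_of_ne_of_ne h h']

/-- Gluing adjacent values forgets only the order of the two elements over `i`, so `σ` is recovered
once `d i` restores that order; the other fibres are singletons. -/
theorem graft_collapse {m : ℕ} (σ : Equiv.Perm (Fin (m + 1))) (i : Fin m)
    (d : ∀ j, Decorated BinaryGen (fibreCard (collapse σ i) j))
    (hd : ∀ a b : Fibre (collapse σ i) i,
      (d i).surj (position _ i a) ≤ (d i).surj (position _ i b) ↔
      σ a ≤ σ b) :
    Decorated.graft (collapse σ i) d = Decorated.ofPerm σ := by
  refine Decorated.binary_ext (fun a b => ?_)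
  rw [Decorated.graft_le_iff]
  change _ ↔ σ a ≤ σ b
  have hcase : ∀ (j : Fin m) (ha : collapse σ i a = j) (hb : collapse σ i b = j),
      (d j).surj (position _ j ⟨a, ha⟩) ≤ (d j).surj (position _ j ⟨b, hb⟩) ↔ σ a ≤ σ b := by
    intro j ha hb
    by_cases hj : j = i
    · subst hj
      exact hd ⟨a, ha⟩ ⟨b, hb⟩
    · have : a = b := σ.injective (eq_of_predAbove_eq (ha.trans hb.symm)
        (fun h => hj (ha.symm.trans h)))
      subst this
      simp
  constructor
  · rintro (h | ⟨h, h'⟩)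
    · exact le_of_not_ge (fun h' => absurd h (not_lt.2 (Fin.predAbove_right_monotone i h')))
    · exact (hcase _ rfl h).1 h'
  · intro h
    rcases (Fin.predAbove_right_monotone i h).lt_or_eq with h' | h'
    · exact Or.inl h'
    · exact Or.inr ⟨h'.symm, (hcase _ rfl h'.symm).2 h⟩

theorem apply_le_iff_of_mem_fibre_collapse {m : ℕ} {σ : Equiv.Perm (Fin (m + 1))} {i : Fin m}
    (a b : Fibre (collapse σ i) i) :
    σ a ≤ σ b ↔ a = b ∨ (a.1 = σ.symm i.castSucc ∧ b.1 = σ.symm i.succ) := by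
  obtain ⟨a, ha⟩ := a
  obtain ⟨b, hb⟩ := b
  have hlt : i.castSucc < i.succ := Fin.castSucc_lt_succ
  simp only [Subtype.mk.injEq, Equiv.eq_symm_apply]
  rw [← σ.injective.eq_iff]
  rcases (predAbove_eq_self_iff i (σ a)).1 ha with h | h <;>
    rcases (predAbove_eq_self_iff i (σ b)).1 hb with h' | h' <;>
    simp [h, h', hlt.le, hlt.not_ge, hlt.ne, hlt.ne']

theorem fibre_collapse_eq_or {m : ℕ} {σ : Equiv.Perm (Fin (m + 1))} {i : Fin m}
    (a : Fibre (collapse σ i) i) : a.1 = σ.symm i.castSucc ∨ a.1 = σ.symm i.succ := by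
  simp only [Equiv.eq_symm_apply]
  exact (predAbove_eq_self_iff i (σ a)).1 a.2

/-- Under `h`, `σ` is increasing on the two-element fibre, as is the identity. -/
theorem graft_collapse_one {m : ℕ} {σ : Equiv.Perm (Fin (m + 1))} {i : Fin m}
    (h : σ.symm i.castSucc < σ.symm i.succ) :
    Decorated.graft (collapse σ i) (fun _ => Decorated.ofPerm 1) = Decorated.ofPerm σ := by
  refine graft_collapse σ i _ (fun a b => ?_)
  refine (position (collapse σ i) i).le_iff_le.trans ?_
  rw [apply_le_iff_of_mem_fibre_collapse, ← Subtype.coe_le_coe, Subtype.ext_iff]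
  rcases fibre_collapse_eq_or a with ha | ha <;> rcases fibre_collapse_eq_or b with hb | hb <;>
    simp [ha, hb, h.le, h.not_ge, (Fin.castSucc_lt_succ (i := i)).ne']

/-- At a descent `σ` is decreasing on the fibre. The transposition appears as `Fin.revPerm`, which
makes sense on every `Fin n`, because the fibre has cardinality `2` only propositionally. -/
theorem graft_collapse_rev {m : ℕ} {σ : Equiv.Perm (Fin (m + 1))} {i : Fin m}
    (h : σ.symm i.succ < σ.symm i.castSucc) :
    Decorated.graft (collapse σ i) (Function.update (fun _ => Decorated.ofPerm 1) i
      (Decorated.ofPerm Fin.revPerm)) = Decorated.ofPerm σ := by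
  refine graft_collapse σ i _ (fun a b => ?_)
  rw [Function.update_self]
  refine Fin.rev_le_rev.trans ((position (collapse σ i) i).le_iff_le.trans ?_)
  rw [apply_le_iff_of_mem_fibre_collapse, ← Subtype.coe_le_coe, Subtype.ext_iff]
  rcases fibre_collapse_eq_or a with ha | ha <;> rcases fibre_collapse_eq_or b with hb | hb <;>
    simp [ha, hb, h.le, h.not_ge, (Fin.castSucc_lt_succ (i := i)).ne']

/-- Exchanging the glued values leaves the collapse unchanged and turns the descent into an ascent.
-/
theorem graft_collapse_one_of_descent {m : ℕ} {σ : Equiv.Perm (Fin (m + 1))} {i : Fin m}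
    (h : σ.symm i.succ < σ.symm i.castSucc) :
    Decorated.graft (collapse σ i) (fun _ => Decorated.ofPerm 1) =
      Decorated.ofPerm (Equiv.swap i.castSucc i.succ * σ) := by
  rw [← graft_collapse_one (σ := Equiv.swap i.castSucc i.succ * σ) (i := i), collapse_swap_mul]
  change σ.symm ((Equiv.swap i.castSucc i.succ).symm _) <
    σ.symm ((Equiv.swap i.castSucc i.succ).symm _)
  simpa using h

/-! ### Inversions and descents -/

theorem inv_one (n : ℕ) : inv (1 : Equiv.Perm (Fin n)) = 0 :=
  inv_eq_zero_of_monotone monotone_id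

theorem inv_revPerm_of_eq_two {n : ℕ} (h : n = 2) : inv (Fin.revPerm : Equiv.Perm (Fin n)) = 1 := by
  subst h
  decide

/-- Both permutations are substitutions into the same collapse and differ only at the vertex `i`,
where the reversal has one inversion and the identity none. Additivity gives the difference. -/
theorem inv_of_descent {m : ℕ} {σ : Equiv.Perm (Fin (m + 1))} {i : Fin m}
    (h : σ.symm i.succ < σ.symm i.castSucc) :
    inv σ = inv (Equiv.swap i.castSucc i.succ * σ : Equiv.Perm (Fin (m + 1))) + 1 := by
  have h1 := inv_graft (collapse σ i) (fun _ => Decorated.ofPerm 1)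
  have h2 := inv_graft (collapse σ i) (Function.update (fun _ => Decorated.ofPerm 1) i
      (Decorated.ofPerm Fin.revPerm))
  rw [graft_collapse_one_of_descent h] at h1
  rw [graft_collapse_rev h, Finset.sum_eq_single_of_mem i (Finset.mem_univ _),
    Function.update_self] at h2
  · change inv σ = _ + inv (Fin.revPerm : Equiv.Perm (Fin (fibreCard (collapse σ i) i))) at h2
    have h3 : ∑ j, inv (Decorated.ofPerm (1 : Equiv.Perm (Fin (fibreCard (collapse σ i) j)))).surj
        = 0 := Finset.sum_eq_zero (fun j _ => inv_one _)
    rw [h3] at h1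
    rw [inv_revPerm_of_eq_two (fibreCard_collapse σ i)] at h2
    exact h2.trans (congrArg (· + 1) h1.symm)
  · intro j _ hj
    rw [Function.update_of_ne hj]
    exact inv_one _

/-- An ascent of `σ` at `i` is a descent of `s_i σ`, so `inv_of_descent` applies to one of the two.
-/
theorem inv_swap_mul_le {m : ℕ} (σ : Equiv.Perm (Fin (m + 1))) (i : Fin m) :
    inv (Equiv.swap i.castSucc i.succ * σ : Equiv.Perm (Fin (m + 1))) ≤ inv σ + 1 := by
  rcases lt_or_gt_of_ne (σ.symm.injective.ne (Fin.castSucc_lt_succ (i := i)).ne) with h | h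
  · have := inv_of_descent (σ := Equiv.swap i.castSucc i.succ * σ) (i := i) (by
      change σ.symm ((Equiv.swap i.castSucc i.succ).symm _) <
        σ.symm ((Equiv.swap i.castSucc i.succ).symm _)
      simpa using h)
    rw [← mul_assoc, Equiv.swap_mul_self, one_mul] at this
    exact this.le
  · rw [inv_of_descent h]
    omega

/-- A finite chain has no order automorphism besides the identity. -/
theorem eq_one_of_strictMono {n : ℕ} {σ : Equiv.Perm (Fin n)} (h : StrictMono σ.symm) :
    σ = 1 := by
  have : h.orderIsoOfSurjective _ σ.symm.surjective = OrderIso.refl _ := Subsingleton.elim _ _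
  refine Equiv.ext (fun a => ?_)
  have := congrArg (fun e => e (σ a)) this
  simpa using this.symm

/-- Induction on permutations, removing descents one at a time. -/
theorem perm_descent_induction {m : ℕ} {p : Equiv.Perm (Fin (m + 1)) → Prop} (one : p 1)
    (step : ∀ (σ : Equiv.Perm (Fin (m + 1))) (i : Fin m), σ.symm i.succ < σ.symm i.castSucc →
      p (Equiv.swap i.castSucc i.succ * σ) → p σ) (σ : Equiv.Perm (Fin (m + 1))) : p σ := by
  -- The inversion number drops by one with each descent removed, and a permutation without descents
  -- is the identity.
  induction hN : inv σ generalizing σ with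
  | zero =>
    rw [eq_one_of_strictMono (σ := σ)]
    · exact one
    · refine Fin.strictMono_iff_lt_succ.2 (fun i => ?_)
      refine lt_of_not_ge (fun h => ?_)
      have := inv_of_descent (h.lt_of_ne (σ.symm.injective.ne (Fin.castSucc_lt_succ).ne'))
      omega
  | succ N ih =>
    by_cases hσ : ∃ i : Fin m, σ.symm i.succ < σ.symm i.castSucc
    · obtain ⟨i, hi⟩ := hσ
      refine step σ i hi (ih _ ?_)
      have := inv_of_descent hi
      omega
    -- Without descents `σ = 1`; this contradicts `inv σ = N + 1`, but `one` closes the case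
    -- directly.
    · rw [eq_one_of_strictMono (σ := σ)]
      · exact one
      · refine Fin.strictMono_iff_lt_succ.2 (fun i => ?_)
        exact (not_lt.1 (fun h => hσ ⟨i, h⟩)).lt_of_ne
          (σ.symm.injective.ne (Fin.castSucc_lt_succ).ne)

/-! ### Coxeter length as the number of inversions -/

theorem inv_prod_le {n : ℕ} (w : List (Equiv.Perm (Fin n)))
    (hw : ∀ s ∈ w, ∃ i j : Fin n, i.1 + 1 = j.1 ∧ s = Equiv.swap i j) :
    inv w.prod ≤ w.length := by
  induction w with
  | nil => exact (inv_one n).le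
  | cons s w ih =>
    obtain ⟨i, j, hij, rfl⟩ := hw s List.mem_cons_self
    have ih := ih (fun s hs => hw s (List.mem_cons_of_mem _ hs))
    obtain ⟨m, rfl⟩ : ∃ m, n = m + 1 := ⟨n - 1, by have := i.2; omega⟩
    have hi : i.1 < m := by have := j.2; omega
    obtain ⟨l, rfl⟩ : ∃ l : Fin m, l.castSucc = i := ⟨⟨i.1, hi⟩, rfl⟩
    obtain rfl : j = l.succ := Fin.ext hij.symm
    -- Each further factor creates at most one inversion.
    rw [List.prod_cons, List.length_cons]
    exact (inv_swap_mul_le _ _).trans (Nat.succ_le_succ ih)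

/-- Recording the transpositions used to remove descents gives a word with one letter per inversion.
-/
theorem exists_word_length_eq_inv {n : ℕ} (σ : Equiv.Perm (Fin n)) :
    ∃ w : List (Equiv.Perm (Fin n)), w.length = inv σ ∧
      (∀ s ∈ w, ∃ i j : Fin n, i.1 + 1 = j.1 ∧ s = Equiv.swap i j) ∧ w.prod = σ := by
  have hone : ∀ n, ∃ w : List (Equiv.Perm (Fin n)), w.length = inv (1 : Equiv.Perm (Fin n)) ∧
      (∀ s ∈ w, ∃ i j : Fin n, i.1 + 1 = j.1 ∧ s = Equiv.swap i j) ∧ w.prod = 1 :=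
    fun n => ⟨[], (inv_one n).symm, by simp, rfl⟩
  cases n with
  | zero => rw [Subsingleton.elim σ 1]; exact hone 0
  | succ m =>
    induction σ using perm_descent_induction with
    | one => exact hone _
    | step σ i hi ih =>
      obtain ⟨w, hl, hw, hp⟩ := ih
      refine ⟨Equiv.swap i.castSucc i.succ :: w, ?_, ?_, ?_⟩
      · rw [List.length_cons, hl, inv_of_descent hi]
      · intro s hs
        rcases List.mem_cons.1 hs with rfl | hs
        · exact ⟨_, _, by simp, rfl⟩
        · exact hw s hs
      · rw [List.prod_cons, hp, ← mul_assoc, Equiv.swap_mul_self, one_mul]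

/-- The Coxeter length of a permutation is its number of inversions. -/
theorem coxeterLength_eq_inv {n : ℕ} (σ : Equiv.Perm (Fin n)) : coxeterLength σ = inv σ := by
  refine le_antisymm (Nat.sInf_le (exists_word_length_eq_inv σ)) ?_
  -- Nonemptiness is needed here, as `sInf ∅ = 0` in `ℕ`.
  refine le_csInf ⟨_, exists_word_length_eq_inv σ⟩ ?_
  rintro r ⟨w, rfl, hw, rfl⟩
  exact inv_prod_le w hw

/-! ### The ideal generated by the relator -/

theorem relator_eq (K : Type u) [CommRing K] (q : K) :
    relator K q = (Finsupp.single (Decorated.ofPerm (Fin.revPerm : Equiv.Perm (Fin 2))) (1 : K) -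
      q • Finsupp.single (Decorated.ofPerm (1 : Equiv.Perm (Fin 2))) (1 : K) :
        Decorated BinaryGen 2 →₀ K) := by
  have h : Equiv.swap (0 : Fin 2) 1 = Fin.revPerm := by decide
  rw [relator, free_compPerm, free_compPerm, h]
  rfl

theorem relator_mem_ker_invForm (K : Type u) [CommRing K] (q : K) :
    invForm K q 2 (relator K q) = 0 := by
  rw [relator_eq, map_sub, map_smul, invForm_single, invForm_single]
  change 1 * q ^ inv (Fin.revPerm : Equiv.Perm (Fin 2)) -
    q • (1 * q ^ inv (1 : Equiv.Perm (Fin 2))) = 0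
  rw [inv_revPerm_of_eq_two rfl, inv_one]
  simp

/-- The kernels of `invForm` form an ideal containing the relator, hence the ideal it generates. -/
theorem idealSpan_relations_le (K : Type u) [CommRing K] (q : K) (n : ℕ)
    (x : Decorated BinaryGen n →₀ K)
    (hx : x ∈ (free K BinaryGen).idealSpan (relations K q) n) : invForm K q n x = 0 := by
  refine ((free K BinaryGen).mem_idealSpan _ n x).1 hx _ (isIdeal_ker_invForm K q) ?_
  rintro (_ | _ | _ | n)
  · exact Set.empty_subset _
  · exact Set.empty_subset _
  · exact Set.singleton_subset_iff.2 (relator_mem_ker_invForm K q)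
  · exact Set.empty_subset _

/-- This lets the relator be placed at a vertex whose fibre has cardinality only provably equal to
`2`. -/
theorem castIdx_relator (K : Type u) [CommRing K] (q : K) {n : ℕ} (h : 2 = n) :
    castIdx (A := fun n => Decorated BinaryGen n →₀ K) h (relator K q) =
      Finsupp.single (Decorated.ofPerm (Fin.revPerm : Equiv.Perm (Fin n))) (1 : K) -
      q • Finsupp.single (Decorated.ofPerm (1 : Equiv.Perm (Fin n))) (1 : K) := by
  subst h
  exact relator_eq K q

theorem castIdx_mem {K : Type u} [CommRing K] {P : Permutad.{u, v} K}
    (I : ∀ n, Submodule K (P.obj n)) {m n : ℕ} (h : m = n) {x : P.obj m} (hx : x ∈ I m) :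
    castIdx h x ∈ I n := by
  subst h
  exact hx

theorem relator_mem_idealSpan (K : Type u) [CommRing K] (q : K) :
    relator K q ∈ (free K BinaryGen).idealSpan (relations K q) 2 :=
  ((free K BinaryGen).mem_idealSpan _ _ _).2 (fun _ _ h => h 2 rfl)

theorem freeComp_update_single (K : Type u) [CommRing K] (X : ℕ → Type) {n k : ℕ} (t : Surj n k)
    (d : ∀ j : Fin k, Decorated X (fibreCard t j)) (i : Fin k)
    (e : Decorated X (fibreCard t i)) :
    freeComp K X t (Function.update (fun j => Finsupp.single (d j) 1) i (Finsupp.single e 1)) =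
      Finsupp.single (Decorated.graft t (Function.update d i e)) 1 := by
  rw [← freeComp_single]
  congr 1
  funext j
  by_cases hj : j = i
  · subst hj
    simp
  · simp [hj]

/-- This element is the composite along `collapse σ i` with the relator at `i` and `μ` at every
other vertex; the two terms of the relator give the two terms here. -/
theorem compPerm_sub_mem_of_descent (K : Type u) [CommRing K] (q : K) {m : ℕ}
    {σ : Equiv.Perm (Fin (m + 1))} {i : Fin m} (h : σ.symm i.succ < σ.symm i.castSucc) :
    (free K BinaryGen).compPerm σ (freeMu K) -
      q • (free K BinaryGen).compPerm (Equiv.swap i.castSucc i.succ * σ) (freeMu K) ∈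
      (free K BinaryGen).idealSpan (relations K q) (m + 1) := by
  have hI := (free K BinaryGen).isIdeal_idealSpan (relations K q) rfl
  have hmem := hI.comp_mem (collapse σ i)
    (Function.update (fun _ => Finsupp.single (Decorated.ofPerm 1) (1 : K)) i
      (castIdx (fibreCard_collapse σ i).symm (relator K q))) i (by
        refine (Function.update_self i _ _).symm ▸ ?_
        exact castIdx_mem _ _ (relator_mem_idealSpan K q))
  change freeComp K BinaryGen (collapse σ i)
    (Function.update (fun _ => Finsupp.single (Decorated.ofPerm 1) (1 : K)) i
      (castIdx (A := fun n => Decorated BinaryGen n →₀ K)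
        (fibreCard_collapse σ i).symm (relator K q))) ∈ _ at hmem
  rw [castIdx_relator, MultilinearMap.map_update_sub, MultilinearMap.map_update_smul,
    freeComp_update_single, freeComp_update_single, graft_collapse_rev h,
    -- In the second term the entry at `i` is again `Decorated.ofPerm 1`, so the updated family is
    -- the constant one.
    Function.update_eq_self_iff.2 rfl, graft_collapse_one_of_descent h] at hmem
  simp only [free_compPerm]
  exact hmem

theorem mkQ_compPerm (K : Type u) [CommRing K] (q : K) {n : ℕ} (σ : Equiv.Perm (Fin n)) :
    ((free K BinaryGen).idealSpan (relations K q) n).mkQ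
        ((free K BinaryGen).compPerm σ (freeMu K)) =
      q ^ inv σ • ((free K BinaryGen).idealSpan (relations K q) n).mkQ
        ((free K BinaryGen).compPerm (1 : Equiv.Perm (Fin n)) (freeMu K)) := by
  cases n with
  | zero => rw [Subsingleton.elim σ 1, inv_one, pow_zero, one_smul]
  | succ m =>
    induction σ using perm_descent_induction with
    | one => rw [inv_one, pow_zero, one_smul]
    | step σ i hi ih =>
      rw [inv_of_descent hi, pow_succ', mul_smul, ← ih, ← map_smul, ← sub_eq_zero, ← map_sub,
        Submodule.mkQ_apply, Submodule.Quotient.mk_eq_zero]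
      exact compPerm_sub_mem_of_descent K q hi

/-! ### The parametrized associative permutad -/

theorem qPermAs_compPerm (K : Type u) [CommRing K] (q : K) {n : ℕ} (σ : Equiv.Perm (Fin n)) :
    (qPermAs K q).compPerm σ (mu K q) =
      ((free K BinaryGen).idealSpan (relations K q) n).mkQ
        ((free K BinaryGen).compPerm σ (freeMu K)) := by
  have hI := (free K BinaryGen).isIdeal_idealSpan (relations K q) rfl
  refine Eq.trans ?_ (hI.quotientComp_mk (permSurj σ)
    (fun j => castIdx (fibreCard_permSurj σ j).symm (freeMu K)))
  simp only [← castIdx_mkQ]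
  rfl

/-- Both sides are linear in `x` and agree on permutations by `mkQ_compPerm`. Thus the projection
factors through `invForm`, which gives surjectivity below. -/
theorem mkQ_eq_invForm_smul (K : Type u) [CommRing K] (q : K) {n : ℕ}
    (x : Decorated BinaryGen n →₀ K) :
    ((free K BinaryGen).idealSpan (relations K q) n).mkQ x =
      invForm K q n x • ((free K BinaryGen).idealSpan (relations K q) n).mkQ
        ((free K BinaryGen).compPerm (1 : Equiv.Perm (Fin n)) (freeMu K)) := by
  have h : (((free K BinaryGen).idealSpan (relations K q) n).mkQ :
        (Decorated BinaryGen n →₀ K) →ₗ[K] _) =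
      (invForm K q n).smulRight (((free K BinaryGen).idealSpan (relations K q) n).mkQ
        ((free K BinaryGen).compPerm (1 : Equiv.Perm (Fin n)) (freeMu K))) := by
    refine Finsupp.basisSingleOne.ext (fun d => ?_)
    obtain ⟨σ, rfl⟩ := d.exists_eq_ofPerm
    rw [Finsupp.coe_basisSingleOne, LinearMap.smulRight_apply, invForm_single, one_mul]
    exact (congrArg _ (free_compPerm K σ).symm).trans (mkQ_compPerm K q σ)
  exact LinearMap.congr_fun h x

/-- The operations of arity `n + 1` of `q`-permAs are the multiples of `Γ(1ₙ; μ, …, μ)`. -/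
theorem bijective_smul_compPerm_one (K : Type u) [CommRing K] (q : K) (n : ℕ) :
    Function.Bijective (LinearMap.toSpanSingleton K ((qPermAs K q).obj n)
      ((qPermAs K q).compPerm (1 : Equiv.Perm (Fin n)) (mu K q))) := by
  constructor
  -- If `c • Γ(1ₙ; μ, …, μ)` lies in the ideal, `invForm` kills it; but its value there is `c`,
  -- because the identity has no inversions.
  · refine (injective_iff_map_eq_zero _).2 (fun c hc => ?_)
    rw [LinearMap.toSpanSingleton_apply, qPermAs_compPerm] at hc
    change c • ((free K BinaryGen).idealSpan (relations K q) n).mkQ _ = 0 at hc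
    rw [← map_smul, Submodule.mkQ_apply, Submodule.Quotient.mk_eq_zero] at hc
    have := idealSpan_relations_le K q n _ hc
    rw [free_compPerm] at this
    have := (map_smul (invForm K q n) c _).symm.trans this
    rw [invForm_single] at this
    change c • (1 * q ^ inv (1 : Equiv.Perm (Fin n))) = 0 at this
    rw [inv_one] at this
    simpa using this
  · intro y
    obtain ⟨x, rfl⟩ := Submodule.mkQ_surjective _ y
    refine ⟨invForm K q n x, ?_⟩
    rw [LinearMap.toSpanSingleton_apply, qPermAs_compPerm]
    exact (mkQ_eq_invForm_smul K q x).symm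

end Permutads

theorem mainTheorem1 {K : Type*} [CommRing K] (q : K) :
    (∀ n : ℕ, ∃ b : Module.Basis (Fin 1) K ((Permutads.qPermAs K q).obj n),
      b 0 = (Permutads.qPermAs K q).compPerm (1 : Equiv.Perm (Fin n)) (Permutads.mu K q)) ∧
    (∀ (n : ℕ) (σ : Equiv.Perm (Fin n)),
      (Permutads.qPermAs K q).compPerm σ (Permutads.mu K q) =
        q ^ Permutads.coxeterLength σ •
          (Permutads.qPermAs K q).compPerm (1 : Equiv.Perm (Fin n)) (Permutads.mu K q)) := by
  refine ⟨fun n => ⟨(Module.Basis.singleton (Fin 1) K).map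
    (LinearEquiv.ofBijective _ (Permutads.bijective_smul_compPerm_one K q n)), ?_⟩,
    fun n σ => ?_⟩
  · simp
  · rw [Permutads.coxeterLength_eq_inv, Permutads.qPermAs_compPerm, Permutads.qPermAs_compPerm]
    exact Permutads.mkQ_compPerm K q σ
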